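/- Let $0<c<C<1/2$ and $\kappa\ge 1$. Let $(X,Z)$ be a random pair with $X$ uniform on $[0,1]$ and $Z\in\{0,1\}$ with conditional distribution $P=P_{Z|X}$ (a Markov kernel from $[0,1]$ to $\{0,1\}$), and put $\eta_P(x)=P(1\,|\,x)$. Let $\Pi(\kappa,c,C)$ be the class of all such $P$ for which there is $\theta\in[0,1]$ such that - $\eta_P(x)<1/2$ for all $x<\theta$ and $\eta_P(x)\ge 1/2$ for all $x\ge\theta$; - $|\eta_P(x)-1/2|\le C|x-\theta|^{\kappa-1}$ for all $x\in[0,1]$; - $c|x-\theta|^{\kappa-1}\le|\eta_P(x)-1/2|$ for all $x\in[0,1]$ in some neighbourhood of $\theta$ (which may depend on $P$), with the convention $0^0=1$. The risk of a measurable classifier $G:[0,1]\to\{0,1\}$ is $R_P(G)=\Pr(G(X)\ne Z)$; the Bayes classifier is $G^*_P(x)=\mathbf 1\{\eta_P(x)\ge 1/2\}$, and $G_\theta(x)=\mathbf 1\{x\ge\theta\}$. An active learning strategy is a sequence of measurable maps $A_t:([0,1]\times\{0,1\})^{t-1}\to[0,1]$, $t=1,2,\dots$. At time $t$ it requests a label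 at $X_t=A_t\big((X_1,Z_1),\dots,(X_{t-1},Z_{t-1})\big)$, the label $Z_t$ is drawn from $P(\cdot\,|\,X_t)$, independently of the past given $X_t$, and the candidate classifier at time $t$ is $G_{X_t}$. Its worst-case expected excess risk at time $t$ is $$r_t=\sup_{P\in\Pi(\kappa,c,C)}\mathbb E_P\big[R_P(G_{X_t})-R_P(G^*_P)\big].$$ **Theorem.** (i) Let $\kappa\in(1,2]$ and $\gamma>0$. If some active learning strategy satisfies $r_t=O(t^{-\gamma})$ as $t\to\infty$, then $\gamma\le\kappa/(2\kappa-2)$. That is, among strategies whose worst-case expected excess risk decays polynomially in $t^{-1}$, none has a decay exponent larger than $\kappa/(2\kappa-2)$. (ii) Let $\kappa=1$. Then $r_t=\Omega(2^{-6C^2t})$: there is a constant $K>0$, depending only on $c$ and $C$, such that $r_t\ge K\,2^{-6C^2t}$ for every active learning strategy and every $t\ge 1$. -/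

import Mathlib

open Set Filter Topology Asymptotics MeasureTheory ProbabilityTheory

noncomputable section

namespace ActiveLearning

/-- The query space `[0,1]`. -/
abbrev Query : Type := Set.Icc (0 : ℝ) 1

/-- A label: `true` stands for `1` and `false` for `0`. -/
abbrev Label : Type := Bool

/-- A conditional distribution `P_{Z|X}` of the label given the point is a kernel from `[0,1]` to
`{0,1}`; this is its regression function `η(x) = E[Z | X = x] = P_{Z|X}(1 | x)`. -/
def regression (P : Kernel Query Label) (x : Query) : ℝ :=
  (P x).real {true}

/-- The joint law of `(X, Z)`: `X` is uniform on `[0,1]` and `Z` given `X` is drawn from `P_{Z|X}`. -/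
def jointLaw (P : Kernel Query Label) : Measure (Query × Label) :=
  (volume : Measure Query) ⊗ₘ P

/-- The risk `R(G) = Pr(G(X) ≠ Z)` of a classifier `G : [0,1] → {0,1}`. -/
def risk (P : Kernel Query Label) (G : Query → Label) : ℝ :=
  (jointLaw P).real {p | G p.1 ≠ p.2}

/-- The Bayes classifier `G*(x) = 1{η(x) ≥ 1/2}`. -/
def bayesClassifier (P : Kernel Query Label) (x : Query) : Label :=
  decide (1 / 2 ≤ regression P x)

/-- The threshold classifier `G_θ(x) = 1{x ≥ θ}`. -/
def thresholdClassifier (θ : Query) (x : Query) : Label :=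
  decide (θ ≤ x)

/-- The excess risk `R(G_x) - R(G*)` of the threshold classifier at `x`. -/
def excessRisk (P : Kernel Query Label) (x : Query) : ℝ :=
  risk P (thresholdClassifier x) - risk P (bayesClassifier P)

/-- The class `Π(κ, c, C)` of conditional distributions of the label whose Bayes classifier is a
threshold classifier, with the two-sided noise condition of exponent `κ` around the threshold
(the lower bound being required only in some neighbourhood of the threshold in `[0,1]`). -/
def noiseClass (κ c C : ℝ) : Set (Kernel Query Label) :=
  {P | IsMarkovKernel P ∧ ∃ θ : Query,
    (∀ x, x < θ → regression P x < 1 / 2) ∧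
    (∀ x, θ ≤ x → 1 / 2 ≤ regression P x) ∧
    (∀ x : Query, |regression P x - 1 / 2| ≤ C * |(x : ℝ) - θ| ^ (κ - 1)) ∧
    (∀ᶠ x : Query in 𝓝 θ, c * |(x : ℝ) - θ| ^ (κ - 1) ≤ |regression P x - 1 / 2|)}

/-- An active strategy: `query t` maps the history `(X_1, Z_1), …, (X_t, Z_t)` to the next query
`X_{t+1}`. -/
structure Strategy where
  query : (t : ℕ) → (Fin t → Query × Label) → Query
  measurable_query : ∀ t, Measurable (query t)

/-- The law of the history `(X_1, Z_1), …, (X_t, Z_t)` when the strategy `A` is run and every label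
`Z_s` is drawn from `P(· | X_s)`. -/
def historyLaw (A : Strategy) (P : Kernel Query Label) : (t : ℕ) → Measure (Fin t → Query × Label)
  | 0 => Measure.dirac Fin.elim0
  | t + 1 =>
    ((historyLaw A P t) ⊗ₘ (P.comap (A.query t) (A.measurable_query t))).map
      fun p : (Fin t → Query × Label) × Label =>
        Fin.snoc (α := fun _ => Query × Label) p.1 (A.query t p.1, p.2)

/-- The expected excess risk `E[R(G_{X_{t+1}}) - R(G*)]` at time `t + 1`. -/
def expectedExcessRisk (A : Strategy) (P : Kernel Query Label) (t : ℕ) : ℝ :=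
  ∫ h, excessRisk P (A.query t h) ∂(historyLaw A P t)

/-- The worst-case expected excess risk over `Π(κ, c, C)` at time `t + 1`. -/
def worstExcessRisk (κ c C : ℝ) (A : Strategy) (t : ℕ) : ℝ :=
  ⨆ P : noiseClass κ c C, expectedExcessRisk A P.1 t

end ActiveLearning

end

/-! Both parts are minimax lower bounds by change of measure. Under two label kernels `P` and `Q` a
strategy chooses its queries by the same maps, so only the labels distinguish the two history laws.
If at every point the chi-square divergence of `P` from `Q` is at most `β`, then adaptivity cannot
help: `P(S) ^ 2 ≤ (1 + β) ^ t * Q(S)` for every event `S` of `t` labels (`sq_real_historyLaw_le`). A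
wrong threshold costs the integral of `|2η - 1|` over the interval between it and the true one
(`mul_volume_le_excessRisk`).

For `κ = 1`, take `N` equally spaced thresholds with jumps `1/2 ± c`, and pure noise `η = 1/2` as
reference, so that `β = 4c²`. The events "the output is within `1/(2N)` of the `i`-th threshold" are
disjoint, so one of them has reference probability at most `1/N`. If `N ≥ 4(1 + 4c²)^t`, its
probability under the matching jump kernel is at most `1/2`, and the risk is at least of order
`1/N`. Finally `1 + 4c² ≤ exp(4c²) ≤ 2^(6C²)`.

For `1 < κ ≤ 2`, two kernels suffice, with thresholds `0` and `δ`. They agree beyond a constant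
multiple of `δ` and differ by `O(δ^(κ-1))` before it, so `β = O(δ^(2κ-2))`. With `δ =
(t+1)^(-1/(2κ-2))` the factor `(1 + β)^t` stays bounded, the two cannot be told apart, and confusing
them costs order `δ^κ = (t+1)^(-κ/(2κ-2))` (`le_worstExcessRisk_of_two_points`). -/

namespace ActiveLearning

/-! ### Kernels with a prescribed regression function -/

/-- The kernel whose label is `1` with probability `η x`. -/
noncomputable def bernoulliKernel (η : Query → ℝ) (hη : Measurable η) : Kernel Query Label where
  toFun x := ENNReal.ofReal (η x) • Measure.dirac true +
    ENNReal.ofReal (1 - η x) • Measure.dirac false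
  measurable' := by
    refine Measure.measurable_of_measurable_coe _ fun s _ => ?_
    simp only [Measure.coe_add, Measure.coe_smul, Pi.add_apply, Pi.smul_apply, smul_eq_mul]
    fun_prop

lemma bernoulliKernel_apply (η : Query → ℝ) (hη : Measurable η) (x : Query) :
    bernoulliKernel η hη x = ENNReal.ofReal (η x) • Measure.dirac true +
      ENNReal.ofReal (1 - η x) • Measure.dirac false := rfl

lemma isMarkovKernel_bernoulliKernel {η : Query → ℝ} (hη : Measurable η)
    (h : ∀ x, η x ∈ Icc (0 : ℝ) 1) : IsMarkovKernel (bernoulliKernel η hη) := by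
  refine ⟨fun x => ⟨?_⟩⟩
  have h0 := (h x).1
  have h1 := (h x).2
  simp only [bernoulliKernel_apply, Measure.coe_add, Measure.coe_smul, Pi.add_apply, Pi.smul_apply,
    smul_eq_mul, measure_univ, mul_one]
  rw [← ENNReal.ofReal_add h0 (by linarith)]
  simp

lemma regression_bernoulliKernel {η : Query → ℝ} (hη : Measurable η)
    (h : ∀ x, η x ∈ Icc (0 : ℝ) 1) (x : Query) :
    regression (bernoulliKernel η hη) x = η x := by
  simp [regression, Measure.real, bernoulliKernel_apply, (h x).1]

lemma lintegral_bernoulliKernel (η : Query → ℝ) (hη : Measurable η) (x : Query)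
    (f : Label → ENNReal) :
    ∫⁻ z, f z ∂(bernoulliKernel η hη x) =
      ENNReal.ofReal (η x) * f true + ENNReal.ofReal (1 - η x) * f false := by
  rw [bernoulliKernel_apply, lintegral_add_measure, lintegral_smul_measure,
    lintegral_smul_measure, lintegral_dirac, lintegral_dirac]
  simp

/-- Cauchy-Schwarz for two Bernoulli laws at bounded chi-square distance. -/
lemma sq_bernoulli_mean_le {p q β u v : ℝ} (hq0 : 0 < q) (hq1 : q < 1)
    (hβ : (p - q) ^ 2 ≤ β * (q * (1 - q))) :
    (p * u + (1 - p) * v) ^ 2 ≤ (1 + β) * (q * u ^ 2 + (1 - q) * v ^ 2) := by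
  have hw : 0 < q * (1 - q) := mul_pos hq0 (by linarith)
  have key : (p * u + (1 - p) * v) ^ 2 * (q * (1 - q)) ≤
      (q * (1 - q) + (p - q) ^ 2) * (q * u ^ 2 + (1 - q) * v ^ 2) := by
    -- Lagrange's identity: the Cauchy-Schwarz defect is a perfect square.
    have : (q * (1 - q) + (p - q) ^ 2) * (q * u ^ 2 + (1 - q) * v ^ 2) -
        (p * u + (1 - p) * v) ^ 2 * (q * (1 - q)) =
        (p * (1 - q) * v - (1 - p) * q * u) ^ 2 := by ring
    nlinarith [sq_nonneg (p * (1 - q) * v - (1 - p) * q * u)]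
  have hS : 0 ≤ q * u ^ 2 + (1 - q) * v ^ 2 :=
    add_nonneg (by positivity) (mul_nonneg (by linarith) (by positivity))
  refine le_of_mul_le_mul_right (key.trans ?_) hw
  nlinarith [mul_le_mul_of_nonneg_right hβ hS]

lemma sq_lintegral_bernoulliKernel_le {p q : Query → ℝ} (hp : Measurable p) (hq : Measurable q)
    {β : ℝ} (hβ0 : 0 ≤ β) {x : Query} (hpx : p x ∈ Icc (0 : ℝ) 1) (hqx : q x ∈ Ioo (0 : ℝ) 1)
    (hβ : (p x - q x) ^ 2 ≤ β * (q x * (1 - q x))) (f : Label → ENNReal) :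
    (∫⁻ z, f z ∂(bernoulliKernel p hp x)) ^ 2 ≤
      ENNReal.ofReal (1 + β) * ∫⁻ z, f z ^ 2 ∂(bernoulliKernel q hq x) := by
  rw [lintegral_bernoulliKernel, lintegral_bernoulliKernel]
  obtain ⟨hq0, hq1⟩ := hqx
  obtain ⟨hp0, hp1⟩ := hpx
  have hc : ENNReal.ofReal (1 + β) ≠ 0 := by simp; linarith
  -- Both labels have positive mass under `q`, so an infinite value of `f` makes the right side
  -- infinite.
  by_cases ht : f true = ⊤
  · have : ENNReal.ofReal (q x) ≠ 0 := by simpa using hq0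
    simp [ht, ENNReal.mul_top, this, hc]
  by_cases hf : f false = ⊤
  · have : ENNReal.ofReal (1 - q x) ≠ 0 := by simpa using hq1
    simp [hf, ENNReal.mul_top, this, hc]
  rw [← ENNReal.ofReal_toReal ht, ← ENNReal.ofReal_toReal hf]
  have hu : 0 ≤ (f true).toReal := ENNReal.toReal_nonneg
  have hv : 0 ≤ (f false).toReal := ENNReal.toReal_nonneg
  have hp' : 0 ≤ 1 - p x := by linarith
  have hq' : 0 ≤ 1 - q x := by linarith
  rw [← ENNReal.ofReal_pow hu, ← ENNReal.ofReal_pow hv, ← ENNReal.ofReal_mul hp0,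
    ← ENNReal.ofReal_mul hp', ← ENNReal.ofReal_mul hq0.le, ← ENNReal.ofReal_mul hq',
    ← ENNReal.ofReal_add (by positivity) (by positivity),
    ← ENNReal.ofReal_add (by positivity) (by positivity), ← ENNReal.ofReal_mul (by positivity),
    ← ENNReal.ofReal_pow (by positivity)]
  exact ENNReal.ofReal_le_ofReal (sq_bernoulli_mean_le hq0 hq1 hβ)

/-! ### Change of measure for histories -/

lemma measurable_snoc_history (A : Strategy) (t : ℕ) :
    Measurable fun p : (Fin t → Query × Label) × Label =>
      Fin.snoc (α := fun _ => Query × Label) p.1 (A.query t p.1, p.2) := by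
  refine measurable_pi_lambda _ fun i => ?_
  have hq := A.measurable_query t
  refine Fin.lastCases ?_ (fun j => ?_) i
  · simp only [Fin.snoc_last]
    fun_prop
  · simp only [Fin.snoc_castSucc]
    fun_prop

instance isProbabilityMeasure_historyLaw (A : Strategy) (P : Kernel Query Label)
    [IsMarkovKernel P] (t : ℕ) : IsProbabilityMeasure (historyLaw A P t) := by
  induction t with
  | zero => rw [historyLaw]; infer_instance
  | succ t ih =>
    rw [historyLaw]
    exact Measure.isProbabilityMeasure_map (measurable_snoc_history A t).aemeasurable

lemma lintegral_historyLaw_succ (A : Strategy) (P : Kernel Query Label) [IsMarkovKernel P] (t : ℕ)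
    {f : (Fin (t + 1) → Query × Label) → ENNReal} (hf : Measurable f) :
    ∫⁻ h, f h ∂(historyLaw A P (t + 1)) =
      ∫⁻ h, ∫⁻ z, f (Fin.snoc (α := fun _ => Query × Label) h (A.query t h, z))
        ∂(P (A.query t h)) ∂(historyLaw A P t) := by
  rw [historyLaw, lintegral_map hf (measurable_snoc_history A t),
    Measure.lintegral_compProd (f := fun p => f (Fin.snoc (α := fun _ => Query × Label) p.1
      (A.query t p.1, p.2))) (hf.comp (measurable_snoc_history A t))]
  rfl

/-- If every single label costs at most a factor `b` in second moment, then `t` adaptively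
requested labels cost at most a factor `b ^ t`. -/
lemma sq_lintegral_historyLaw_le (A : Strategy) (P Q : Kernel Query Label) [IsMarkovKernel P]
    [IsMarkovKernel Q] {b : ENNReal}
    (h : ∀ x (f : Label → ENNReal), (∫⁻ z, f z ∂(P x)) ^ 2 ≤ b * ∫⁻ z, f z ^ 2 ∂(Q x)) (t : ℕ)
    (f : (Fin t → Query × Label) → ENNReal) (hf : Measurable f) :
    (∫⁻ w, f w ∂(historyLaw A P t)) ^ 2 ≤ b ^ t * ∫⁻ w, f w ^ 2 ∂(historyLaw A Q t) := by
  induction t with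
  | zero => simp [historyLaw, lintegral_dirac]
  | succ t ih =>
    have hm : Measurable fun w : Fin t → Query × Label =>
        ∫⁻ z, f (Fin.snoc (α := fun _ => Query × Label) w (A.query t w, z))
          ∂(P (A.query t w)) :=
      (hf.comp (measurable_snoc_history A t)).lintegral_kernel_prod_right'
        (κ := P.comap (A.query t) (A.measurable_query t))
    have hm' : Measurable fun w : Fin t → Query × Label =>
        ∫⁻ z, f (Fin.snoc (α := fun _ => Query × Label) w (A.query t w, z)) ^ 2
          ∂(Q (A.query t w)) :=
      ((hf.pow_const 2).comp (measurable_snoc_history A t)).lintegral_kernel_prod_right'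
        (κ := Q.comap (A.query t) (A.measurable_query t))
    rw [lintegral_historyLaw_succ A P t hf, lintegral_historyLaw_succ A Q t (hf.pow_const 2)]
    -- The induction hypothesis is applied to the conditional mean of `f` under `P` given the first
    -- `t` pairs; the last label is then exchanged by `h`.
    calc _ ≤ b ^ t * ∫⁻ w, (∫⁻ z, f (Fin.snoc (α := fun _ => Query × Label) w (A.query t w, z))
          ∂(P (A.query t w))) ^ 2 ∂(historyLaw A Q t) := ih _ hm
      _ ≤ b ^ t * ∫⁻ w, b * ∫⁻ z, f (Fin.snoc (α := fun _ => Query × Label) w (A.query t w, z)) ^ 2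
          ∂(Q (A.query t w)) ∂(historyLaw A Q t) := by
        gcongr with w
        exact h _ _
      _ = _ := by rw [lintegral_const_mul _ hm', ← mul_assoc, ← pow_succ]

/-- An indicator equals its square, so the second moment on the right is a plain probability: an
event that is rare enough under `q` is rare under `p`. -/
lemma sq_real_historyLaw_le (A : Strategy) {p q : Query → ℝ} (hp : Measurable p)
    (hq : Measurable q) {β : ℝ} (hβ0 : 0 ≤ β) (hpx : ∀ x, p x ∈ Icc (0 : ℝ) 1)
    (hqx : ∀ x, q x ∈ Ioo (0 : ℝ) 1) (hβ : ∀ x, (p x - q x) ^ 2 ≤ β * (q x * (1 - q x)))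
    (t : ℕ) {S : Set (Fin t → Query × Label)} (hS : MeasurableSet S) :
    (historyLaw A (bernoulliKernel p hp) t).real S ^ 2 ≤
      (1 + β) ^ t * (historyLaw A (bernoulliKernel q hq) t).real S := by
  have := isMarkovKernel_bernoulliKernel hp hpx
  have := isMarkovKernel_bernoulliKernel hq fun x => Ioo_subset_Icc_self (hqx x)
  have key := sq_lintegral_historyLaw_le A (bernoulliKernel p hp) (bernoulliKernel q hq)
    (fun x f => sq_lintegral_bernoulliKernel_le hp hq hβ0 (hpx x) (hqx x) (hβ x) f) t
    (S.indicator 1) (measurable_one.indicator hS)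
  have hind : ∀ w, (S.indicator (1 : (Fin t → Query × Label) → ENNReal) w) ^ 2 = S.indicator 1 w := fun w => by
    by_cases hw : w ∈ S <;> simp [hw]
  simp only [hind] at key
  rw [lintegral_indicator_one hS, lintegral_indicator_one hS] at key
  have h2 := ENNReal.toReal_mono (by finiteness) key
  rw [ENNReal.toReal_mul, ENNReal.toReal_pow, ENNReal.toReal_pow,
    ENNReal.toReal_ofReal (by linarith)] at h2
  exact h2

/-! ### Excess risk -/

lemma measurable_regression (P : Kernel Query Label) : Measurable (regression P) :=
  (P.measurable_coe (measurableSet_singleton true)).ennreal_toReal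

lemma measurable_bayesClassifier (P : Kernel Query Label) : Measurable (bayesClassifier P) :=
  measurable_to_bool (by
    have : bayesClassifier P ⁻¹' {true} = {x | 1 / 2 ≤ regression P x} := by
      ext; simp [bayesClassifier]
    rw [this]
    exact measurableSet_le measurable_const (measurable_regression P))

lemma measurable_thresholdClassifier (θ : Query) : Measurable (thresholdClassifier θ) :=
  measurable_to_bool (by
    have : thresholdClassifier θ ⁻¹' {true} = Ici θ := by ext; simp [thresholdClassifier]
    rw [this]
    exact measurableSet_Ici)

lemma measurableSet_error {G : Query → Label} (hG : Measurable G) :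
    MeasurableSet {p : Query × Label | G p.1 ≠ p.2} :=
  (measurableSet_eq_fun (hG.comp measurable_fst) measurable_snd).compl

/-- The probability that the label at `x` differs from the predicted label `z`. -/
noncomputable def pointLoss (P : Kernel Query Label) (z : Label) (x : Query) : ℝ :=
  if z then 1 - regression P x else regression P x

lemma pointLoss_eq (P : Kernel Query Label) [IsMarkovKernel P] (z : Label) (x : Query) :
    (P x).real {y | z ≠ y} = pointLoss P z x := by
  cases z
  · have : {y : Bool | false ≠ y} = {true} := by ext y; cases y <;> simp
    rw [this]
    rfl
  · have : {y : Bool | true ≠ y} = {true}ᶜ := by ext y; cases y <;> simp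
    rw [this, probReal_compl_eq_one_sub (measurableSet_singleton true)]
    rfl

lemma measurable_pointLoss (P : Kernel Query Label) {G : Query → Label} (hG : Measurable G) :
    Measurable fun x => pointLoss P (G x) x :=
  Measurable.ite (hG (measurableSet_singleton true))
    (measurable_const.sub (measurable_regression P)) (measurable_regression P)

lemma integrable_pointLoss (P : Kernel Query Label) [IsMarkovKernel P] {G : Query → Label}
    (hG : Measurable G) : Integrable (fun x => pointLoss P (G x) x) volume := by
  refine Integrable.of_bound (measurable_pointLoss P hG).aestronglyMeasurable 1
    (Eventually.of_forall fun x => ?_)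
  rw [← pointLoss_eq, Real.norm_of_nonneg measureReal_nonneg]
  exact measureReal_le_one

lemma risk_eq_integral (P : Kernel Query Label) [IsMarkovKernel P] {G : Query → Label}
    (hG : Measurable G) : risk P G = ∫ x, pointLoss P (G x) x := by
  simp only [← pointLoss_eq, risk, jointLaw, Measure.real]
  rw [Measure.compProd_apply (measurableSet_error hG), ← integral_toReal
    (Kernel.measurable_kernel_prodMk_left (measurableSet_error hG)).aemeasurable
    (Eventually.of_forall fun x => measure_lt_top _ _)]
  rfl

lemma pointLoss_bayes_add_le (P : Kernel Query Label) (z : Label) (x : Query)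
    (hz : z ≠ bayesClassifier P x) :
    pointLoss P (bayesClassifier P x) x + 2 * |regression P x - 1 / 2| ≤ pointLoss P z x := by
  by_cases h : 1 / 2 ≤ regression P x
  · have hb : bayesClassifier P x = true := by simp only [bayesClassifier, h, decide_true]
    rw [hb] at hz ⊢
    obtain rfl : z = false := by cases z <;> simp_all
    rw [abs_of_nonneg (by linarith)]
    simp only [pointLoss, if_true]
    norm_num
    linarith
  · have hb : bayesClassifier P x = false := by simp only [bayesClassifier, h, decide_false]
    rw [hb] at hz ⊢
    obtain rfl : z = true := by cases z <;> simp_all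
    rw [abs_of_nonpos (by linarith)]
    simp only [pointLoss, if_true]
    norm_num
    linarith

/-- The excess risk is the integral of a difference of pointwise losses that is nonnegative
everywhere and at least `2 * m` on `S`. -/
lemma mul_volume_le_excessRisk (P : Kernel Query Label) [IsMarkovKernel P] (x : Query)
    {S : Set Query} (hS : MeasurableSet S) {m : ℝ}
    (hne : ∀ y ∈ S, thresholdClassifier x y ≠ bayesClassifier P y)
    (hm : ∀ y ∈ S, m ≤ |regression P y - 1 / 2|) :
    2 * m * (volume : Measure Query).real S ≤ excessRisk P x := by
  have hG := measurable_thresholdClassifier x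
  have hB := measurable_bayesClassifier P
  have hint := (integrable_pointLoss P hG).sub (integrable_pointLoss P hB)
  rw [excessRisk, risk_eq_integral P hG, risk_eq_integral P hB,
    ← integral_sub (integrable_pointLoss P hG) (integrable_pointLoss P hB)]
  refine (setIntegral_ge_of_const_le_real hS (measure_ne_top _ _) (fun y hy => ?_)
    hint.integrableOn).trans (setIntegral_le_integral hint (Eventually.of_forall fun y => ?_))
  · have := pointLoss_bayes_add_le P _ y (hne y hy)
    have := hm y hy
    simp only [Pi.sub_apply]
    linarith
  · by_cases h : thresholdClassifier x y = bayesClassifier P y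
    · simp [h]
    · have := pointLoss_bayes_add_le P _ y h
      have := abs_nonneg (regression P y - 1 / 2)
      simp only [Pi.sub_apply, Pi.zero_apply]
      linarith

lemma excessRisk_nonneg (P : Kernel Query Label) [IsMarkovKernel P] (x : Query) :
    0 ≤ excessRisk P x := by
  simpa using mul_volume_le_excessRisk P x MeasurableSet.empty (m := 0) (by simp) (by simp)

lemma excessRisk_le_one (P : Kernel Query Label) [IsMarkovKernel P] (x : Query) :
    excessRisk P x ≤ 1 := by
  have h1 : risk P (thresholdClassifier x) ≤ 1 := by
    rw [risk, jointLaw]; exact measureReal_le_one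
  have h2 : 0 ≤ risk P (bayesClassifier P) := measureReal_nonneg
  rw [excessRisk]
  linarith

/-- The error set is jointly measurable in the threshold and the labelled point, so the measure of
its sections is measurable in the threshold. -/
lemma measurable_excessRisk (P : Kernel Query Label) [IsMarkovKernel P] :
    Measurable (excessRisk P) := by
  refine Measurable.sub_const ?_ _
  have hG : Measurable fun p : Query × (Query × Label) => thresholdClassifier p.1 p.2.1 :=
    measurable_to_bool (by
      simpa [thresholdClassifier, preimage] using
        measurableSet_le (measurable_fst (α := Query) (β := Query × Label))
          (measurable_fst.comp measurable_snd))
  have hS : MeasurableSet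
      {p : Query × (Query × Label) | thresholdClassifier p.1 p.2.1 ≠ p.2.2} :=
    (measurableSet_eq_fun hG (by fun_prop)).compl
  have : SFinite (jointLaw P) := by rw [jointLaw]; infer_instance
  exact (measurable_measure_prodMk_left (ν := jointLaw P) hS).ennreal_toReal

lemma integrable_excessRisk_query (A : Strategy) (P : Kernel Query Label) [IsMarkovKernel P]
    (t : ℕ) : Integrable (fun h => excessRisk P (A.query t h)) (historyLaw A P t) := by
  refine Integrable.of_bound
    ((measurable_excessRisk P).comp (A.measurable_query t)).aestronglyMeasurable 1
    (Eventually.of_forall fun h => ?_)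
  rw [Real.norm_of_nonneg (excessRisk_nonneg P _)]
  exact excessRisk_le_one P _

lemma expectedExcessRisk_le_one (A : Strategy) (P : Kernel Query Label) [IsMarkovKernel P]
    (t : ℕ) : expectedExcessRisk A P t ≤ 1 := by
  have := integral_mono (integrable_excessRisk_query A P t) (integrable_const 1)
    fun h => excessRisk_le_one P (A.query t h)
  simpa [expectedExcessRisk] using this

lemma mul_historyLaw_le_expectedExcessRisk (A : Strategy) (P : Kernel Query Label)
    [IsMarkovKernel P] (t : ℕ) {S : Set (Fin t → Query × Label)} (hS : MeasurableSet S) {m : ℝ}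
    (hm : ∀ h ∈ S, m ≤ excessRisk P (A.query t h)) :
    m * (historyLaw A P t).real S ≤ expectedExcessRisk A P t :=
  (setIntegral_ge_of_const_le_real hS (measure_ne_top _ _) hm
    (integrable_excessRisk_query A P t).integrableOn).trans
    (setIntegral_le_integral (integrable_excessRisk_query A P t)
      (Eventually.of_forall fun _ => excessRisk_nonneg P _))

/-- A real supremum dominates its members only when the family is bounded above; here the bound is
`1`. -/
lemma expectedExcessRisk_le_worstExcessRisk {κ c C : ℝ} (A : Strategy) {P : Kernel Query Label}
    (hP : P ∈ noiseClass κ c C) (t : ℕ) :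
    expectedExcessRisk A P t ≤ worstExcessRisk κ c C A t := by
  refine le_ciSup (f := fun P : noiseClass κ c C => expectedExcessRisk A P.1 t) ⟨1, ?_⟩ ⟨P, hP⟩
  rintro _ ⟨⟨Q, hQ, -⟩, rfl⟩
  exact expectedExcessRisk_le_one A Q t

lemma bernoulliKernel_mem_noiseClass {κ c C : ℝ} {η : Query → ℝ} (hη : Measurable η)
    (h01 : ∀ x, η x ∈ Icc (0 : ℝ) 1) (θ : Query) (hlt : ∀ x, x < θ → η x < 1 / 2)
    (hge : ∀ x, θ ≤ x → 1 / 2 ≤ η x)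
    (hup : ∀ x : Query, |η x - 1 / 2| ≤ C * |(x : ℝ) - θ| ^ (κ - 1))
    (hlow : ∀ᶠ x : Query in 𝓝 θ, c * |(x : ℝ) - θ| ^ (κ - 1) ≤ |η x - 1 / 2|) :
    bernoulliKernel η hη ∈ noiseClass κ c C := by
  refine ⟨isMarkovKernel_bernoulliKernel hη h01, θ, ?_⟩
  simp only [regression_bernoulliKernel hη h01]
  exact ⟨hlt, hge, hup, hlow⟩

/-- A threshold classifier errs between its threshold and the true one. -/
lemma thresholdClassifier_ne_bayesClassifier {η : Query → ℝ} (hη : Measurable η)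
    (h01 : ∀ x, η x ∈ Icc (0 : ℝ) 1) {θ : Query} (hlt : ∀ x, x < θ → η x < 1 / 2)
    (hge : ∀ x, θ ≤ x → 1 / 2 ≤ η x) {x y : Query} (h : y ∈ Ico (min x θ) (max x θ)) :
    thresholdClassifier x y ≠ bayesClassifier (bernoulliKernel η hη) y := by
  simp only [thresholdClassifier, bayesClassifier, regression_bernoulliKernel hη h01]
  obtain ⟨h1, h2⟩ := h
  rcases le_total x θ with hx | hx
  · rw [min_eq_left hx] at h1
    rw [max_eq_right hx] at h2
    have := hlt y h2
    rw [decide_eq_true h1, decide_eq_false (not_le.2 this)]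
    decide
  · rw [min_eq_right hx] at h1
    rw [max_eq_left hx] at h2
    rw [decide_eq_true (hge y h1), decide_eq_false (not_le.2 h2)]
    decide

lemma volume_real_Ico (x y : Query) (h : x ≤ y) :
    (volume : Measure Query).real (Ico x y) = y - x := by
  have : (volume : Measure Query) (Ico x y) = ENNReal.ofReal (y - x) := unitInterval.volume_Ico x y
  rw [Measure.real, this, ENNReal.toReal_ofReal (sub_nonneg.2 h)]

/-! ### The case `κ = 1` -/

/-- The regression function jumping from `1/2 - c` to `1/2 + c` at `θ`. -/
noncomputable def jumpRegression (c : ℝ) (θ x : Query) : ℝ :=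
  if x < θ then 1 / 2 - c else 1 / 2 + c

lemma measurable_jumpRegression (c : ℝ) (θ : Query) : Measurable (jumpRegression c θ) :=
  Measurable.ite measurableSet_Iio measurable_const measurable_const

lemma jumpRegression_mem_Icc {c : ℝ} (hc : 0 < c) (hc2 : c < 1 / 2) (θ x : Query) :
    jumpRegression c θ x ∈ Icc (0 : ℝ) 1 := by
  unfold jumpRegression
  split_ifs <;> constructor <;> linarith

lemma jumpRegression_lt {c : ℝ} (hc : 0 < c) (θ x : Query) (h : x < θ) :
    jumpRegression c θ x < 1 / 2 := by
  rw [jumpRegression, if_pos h]; linarith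

lemma le_jumpRegression {c : ℝ} (hc : 0 < c) (θ x : Query) (h : θ ≤ x) :
    1 / 2 ≤ jumpRegression c θ x := by
  rw [jumpRegression, if_neg (not_lt.2 h)]; linarith

lemma abs_jumpRegression_sub {c : ℝ} (hc : 0 < c) (θ x : Query) :
    |jumpRegression c θ x - 1 / 2| = c := by
  unfold jumpRegression
  split_ifs
  · rw [abs_of_neg] <;> linarith
  · rw [abs_of_pos] <;> linarith

lemma jump_mem_noiseClass {c C : ℝ} (hc : 0 < c) (hcC : c < C) (hC : C < 1 / 2) (θ : Query) :
    bernoulliKernel (jumpRegression c θ) (measurable_jumpRegression c θ) ∈ noiseClass 1 c C := by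
  refine bernoulliKernel_mem_noiseClass _ (jumpRegression_mem_Icc hc (by linarith) θ) θ
    (jumpRegression_lt hc θ) (le_jumpRegression hc θ) (fun x => ?_)
    (Eventually.of_forall fun x => ?_)
  · rw [abs_jumpRegression_sub hc]; simpa using hcC.le
  · rw [abs_jumpRegression_sub hc]; simp

lemma mul_dist_le_excessRisk_jump {c : ℝ} (hc : 0 < c) (hc2 : c < 1 / 2) (θ x : Query) :
    2 * c * |(x : ℝ) - θ| ≤
      excessRisk (bernoulliKernel (jumpRegression c θ) (measurable_jumpRegression c θ)) x := by
  have h01 := jumpRegression_mem_Icc hc hc2 θ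
  have := isMarkovKernel_bernoulliKernel (measurable_jumpRegression c θ) h01
  have h := mul_volume_le_excessRisk
    (bernoulliKernel (jumpRegression c θ) (measurable_jumpRegression c θ)) x
    (S := Ico (min x θ) (max x θ)) measurableSet_Ico (m := c)
    (fun y hy => thresholdClassifier_ne_bayesClassifier _ h01 (jumpRegression_lt hc θ)
      (le_jumpRegression hc θ) hy)
    (fun y _ => by
      rw [regression_bernoulliKernel _ h01, abs_jumpRegression_sub hc])
  rw [volume_real_Ico _ _ min_le_max] at h
  rcases le_total x θ with hx | hx
  · rw [min_eq_left hx, max_eq_right hx] at h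
    rwa [abs_sub_comm, abs_of_nonneg (sub_nonneg.2 (show (x : ℝ) ≤ θ from hx))]
  · rw [min_eq_right hx, max_eq_left hx] at h
    rwa [abs_of_nonneg (sub_nonneg.2 (show (θ : ℝ) ≤ x from hx))]

/-- Among finitely many disjoint events one has probability at most the average. -/
lemma exists_measureReal_mul_card_le {Ω : Type*} [MeasurableSpace Ω] (μ : Measure Ω)
    [IsProbabilityMeasure μ] {N : ℕ} (hN : 0 < N) (S : Fin N → Set Ω)
    (hS : ∀ i, MeasurableSet (S i)) (hd : Pairwise (Function.onFun Disjoint S)) :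
    ∃ i, μ.real (S i) * N ≤ 1 := by
  by_contra! h
  have : Nonempty (Fin N) := ⟨⟨0, hN⟩⟩
  have h1 : ∑ i, μ.real (S i) ≤ 1 := by
    rw [← measureReal_iUnion_fintype hd hS]
    exact measureReal_le_one
  have h2 : ∑ _i : Fin N, (1 : ℝ) < ∑ i, μ.real (S i) * N :=
    Finset.sum_lt_sum_of_nonempty Finset.univ_nonempty fun i _ => h i
  rw [← Finset.sum_mul] at h2
  simp only [Finset.sum_const, Finset.card_univ, Fintype.card_fin, nsmul_eq_mul, mul_one] at h2
  have : (0 : ℝ) < N := by exact_mod_cast hN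
  nlinarith

lemma worstExcessRisk_one_ge_of_grid {c C : ℝ} (hc : 0 < c) (hcC : c < C) (hC : C < 1 / 2)
    (A : Strategy) (t : ℕ) {N : ℕ} (hN : 4 * (1 + 4 * c ^ 2) ^ t ≤ N) :
    c / (2 * N) ≤ worstExcessRisk 1 c C A t := by
  have hN0 : (0 : ℝ) < N := lt_of_lt_of_le (by positivity) hN
  let θ : Fin N → Query := fun i => ⟨(i : ℝ) / N, by positivity,
    (div_le_one hN0).2 (by exact_mod_cast i.2.le)⟩
  let S : Fin N → Set (Fin t → Query × Label) :=
    fun i => {h | |(A.query t h : ℝ) - θ i| < 1 / (2 * N)}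
  have hS : ∀ i, MeasurableSet (S i) := fun i =>
    measurableSet_lt (((measurable_subtype_coe.comp (A.measurable_query t)).sub_const _).abs)
      measurable_const
  have hd : Pairwise (Function.onFun Disjoint S) := by
    refine fun i j hij => Set.disjoint_left.2 fun h hi hj => hij ?_
    have h1 : |(A.query t h : ℝ) - i / N| < 1 / (2 * N) := hi
    have h2 : |(A.query t h : ℝ) - j / N| < 1 / (2 * N) := hj
    have h3 : |(i : ℝ) / N - j / N| < 1 / N := by
      calc _ ≤ |(i : ℝ) / N - A.query t h| + |(A.query t h : ℝ) - j / N| := abs_sub_le _ _ _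
        _ < 1 / (2 * N) + 1 / (2 * N) := by rw [abs_sub_comm]; exact add_lt_add h1 h2
        _ = 1 / N := by field_simp; norm_num
    rw [← sub_div, abs_div, abs_of_pos hN0, div_lt_div_iff_of_pos_right hN0] at h3
    have h4 : |(i : ℤ) - j| < 1 := by exact_mod_cast h3
    rw [Int.abs_lt_one_iff] at h4
    exact Fin.ext (by omega)
  have hq : ∀ _x : Query, (1 / 2 : ℝ) ∈ Ioo (0 : ℝ) 1 := fun _ => by norm_num
  have := isMarkovKernel_bernoulliKernel (η := fun _ => 1 / 2) measurable_const
    fun x => Ioo_subset_Icc_self (hq x)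
  obtain ⟨i, hi⟩ := exists_measureReal_mul_card_le
    (historyLaw A (bernoulliKernel (fun _ => 1 / 2) measurable_const) t)
    (by exact_mod_cast hN0) S hS hd
  have h01 := jumpRegression_mem_Icc hc (hcC.trans hC) (θ i)
  have := isMarkovKernel_bernoulliKernel (measurable_jumpRegression c (θ i)) h01
  set μ := historyLaw A (bernoulliKernel _ (measurable_jumpRegression c (θ i))) t
  set ν := historyLaw A (bernoulliKernel (fun _ => 1 / 2) measurable_const) t
  have hsq : μ.real (S i) ^ 2 ≤ (1 + 4 * c ^ 2) ^ t * ν.real (S i) := by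
    refine sq_real_historyLaw_le A (measurable_jumpRegression c (θ i)) measurable_const
      (by positivity) h01 hq (fun x => ?_) t (hS i)
    rw [← sq_abs, abs_jumpRegression_sub hc]
    linarith
  have hhalf : μ.real (S i) ≤ 1 / 2 := by
    have hν : 0 ≤ ν.real (S i) := measureReal_nonneg
    -- By `hN` the factor `(1 + 4c²)^t` is at most `N/4`, while `ν.real (S i) * N ≤ 1`.
    have : μ.real (S i) ^ 2 ≤ (1 / 2) ^ 2 := by nlinarith
    exact le_of_sq_le_sq this (by norm_num)
  have hcompl : μ.real (S i)ᶜ = 1 - μ.real (S i) := probReal_compl_eq_one_sub (hS i)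
  have hlow := mul_historyLaw_le_expectedExcessRisk A
    (bernoulliKernel _ (measurable_jumpRegression c (θ i))) t (hS i).compl (m := c / N)
    (fun h hh => by
      have h1 : 1 / (2 * N) ≤ |(A.query t h : ℝ) - θ i| := not_lt.1 hh
      calc c / N = 2 * c * (1 / (2 * N)) := by field_simp
        _ ≤ 2 * c * |(A.query t h : ℝ) - θ i| := by gcongr
        _ ≤ _ := mul_dist_le_excessRisk_jump hc (hcC.trans hC) (θ i) _)
  refine le_trans ?_ (hlow.trans
    (expectedExcessRisk_le_worstExcessRisk A (jump_mem_noiseClass hc hcC hC (θ i)) t))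
  calc c / (2 * N) = c / N * (1 / 2) := by field_simp
    _ ≤ c / N * μ.real (S i)ᶜ := by
      rw [hcompl]
      gcongr
      linarith

lemma one_add_four_mul_sq_pow_le {c C : ℝ} (hc : 0 < c) (hcC : c < C) (t : ℕ) :
    (1 + 4 * c ^ 2) ^ t ≤ (2 : ℝ) ^ (6 * C ^ 2 * ((t : ℝ) + 1)) := by
  have h2 : (2 / 3 : ℝ) ≤ Real.log 2 := by linarith [Real.log_two_gt_d9]
  calc (1 + 4 * c ^ 2) ^ t ≤ (Real.exp (4 * c ^ 2)) ^ t := by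
        gcongr
        linarith [Real.add_one_le_exp (4 * c ^ 2)]
    _ = Real.exp (t * (4 * c ^ 2)) := (Real.exp_nat_mul _ _).symm
    _ ≤ Real.exp (Real.log 2 * (6 * C ^ 2 * ((t : ℝ) + 1))) := by
        refine Real.exp_le_exp.2 ?_
        -- The bound `log 2 ≥ 2/3` is what turns the constant `4` into `6`.
        calc (t : ℝ) * (4 * c ^ 2) ≤ (t + 1) * (4 * C ^ 2) := by gcongr; linarith
          _ = 2 / 3 * (6 * C ^ 2 * ((t : ℝ) + 1)) := by ring
          _ ≤ _ := by gcongr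
    _ = _ := by rw [Real.rpow_def_of_pos two_pos]

lemma worstExcessRisk_one_ge {c C : ℝ} (hc : 0 < c) (hcC : c < C) (hC : C < 1 / 2)
    (A : Strategy) (t : ℕ) :
    c / 10 * (2 : ℝ) ^ (-(6 * C ^ 2 * ((t : ℝ) + 1))) ≤ worstExcessRisk 1 c C A t := by
  refine le_trans ?_ (worstExcessRisk_one_ge_of_grid hc hcC hC A t (Nat.le_ceil _))
  have h1 : (1 : ℝ) ≤ (1 + 4 * c ^ 2) ^ t := one_le_pow₀ (by nlinarith)
  have h2 := one_add_four_mul_sq_pow_le hc hcC t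
  -- Rounding up costs at most `1 ≤ (1 + 4c²)^t`, hence `5` in place of `4`, and `c / 10` at the
  -- end.
  have h3 : (⌈4 * (1 + 4 * c ^ 2) ^ t⌉₊ : ℝ) ≤ 5 * (2 : ℝ) ^ (6 * C ^ 2 * ((t : ℝ) + 1)) := by
    have := (Nat.ceil_lt_add_one (by positivity : 0 ≤ 4 * (1 + 4 * c ^ 2) ^ t)).le
    linarith
  have h4 : (0 : ℝ) < ⌈4 * (1 + 4 * c ^ 2) ^ t⌉₊ :=
    lt_of_lt_of_le (by positivity) (Nat.le_ceil (4 * (1 + 4 * c ^ 2) ^ t))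
  rw [Real.rpow_neg two_pos.le, ← div_eq_mul_inv, div_div]
  exact div_le_div_of_nonneg_left hc.le (by positivity) (by linarith)

/-! ### The case `1 < κ ≤ 2` -/

/-- The regression function `1/2 + c x^p`, with threshold `0`. -/
noncomputable def powerRegression (c p : ℝ) (x : Query) : ℝ :=
  1 / 2 + c * (x : ℝ) ^ p

/-- A perturbation of `powerRegression` on `[0, L δ)`, with threshold `δ`. -/
noncomputable def shiftedRegression (c p L : ℝ) (δ x : Query) : ℝ :=
  if x < δ then 1 / 2 - c * ((δ : ℝ) - x) ^ p
  else if (x : ℝ) < L * δ then 1 / 2 + c * ((x : ℝ) - δ) ^ p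
  else 1 / 2 + c * (x : ℝ) ^ p

lemma measurable_powerRegression (c p : ℝ) : Measurable (powerRegression c p) := by
  unfold powerRegression
  fun_prop

lemma measurable_shiftedRegression (c p L : ℝ) (δ : Query) :
    Measurable (shiftedRegression c p L δ) := by
  refine Measurable.ite measurableSet_Iio (by fun_prop) (Measurable.ite ?_ (by fun_prop)
    (by fun_prop))
  exact measurableSet_lt measurable_subtype_coe measurable_const

lemma mul_rpow_mem_Icc {c p u : ℝ} (hc : 0 < c) (hp : 0 ≤ p) (hu : u ∈ Icc (0 : ℝ) 1) :
    c * u ^ p ∈ Icc (0 : ℝ) c := by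
  have h1 : u ^ p ≤ 1 := Real.rpow_le_one hu.1 hu.2 hp
  have h0 : 0 ≤ u ^ p := Real.rpow_nonneg hu.1 p
  exact ⟨by positivity, by nlinarith⟩

lemma powerRegression_mem_Icc {c p : ℝ} (hc : 0 < c) (hp : 0 ≤ p) (x : Query) :
    powerRegression c p x ∈ Icc (1 / 2 : ℝ) (1 / 2 + c) := by
  have := mul_rpow_mem_Icc hc hp x.2
  constructor <;> unfold powerRegression <;> linarith [this.1, this.2]

lemma powerRegression_mem_Ioo {c p : ℝ} (hc : 0 < c) (hc2 : c < 1 / 2) (hp : 0 ≤ p) (x : Query) :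
    powerRegression c p x ∈ Ioo (0 : ℝ) 1 := by
  have := powerRegression_mem_Icc hc hp x
  constructor <;> linarith [this.1, this.2]

lemma shiftedRegression_mem_Icc {c p : ℝ} (L : ℝ) (hc : 0 < c) (hc2 : c < 1 / 2) (hp : 0 ≤ p)
    (δ x : Query) : shiftedRegression c p L δ x ∈ Icc (0 : ℝ) 1 := by
  have hx := x.2
  have hδ := δ.2
  unfold shiftedRegression
  split_ifs with h1 h2
  · have h1' : (x : ℝ) < δ := h1
    have := mul_rpow_mem_Icc hc hp (u := (δ : ℝ) - x) ⟨by linarith, by linarith [hx.1, hδ.2]⟩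
    constructor <;> linarith [this.1, this.2]
  · have h1' : (δ : ℝ) ≤ x := not_lt.1 h1
    have := mul_rpow_mem_Icc hc hp (u := (x : ℝ) - δ) ⟨by linarith, by linarith [hx.2, hδ.1]⟩
    constructor <;> linarith [this.1, this.2]
  · have := mul_rpow_mem_Icc hc hp hx
    constructor <;> linarith [this.1, this.2]

lemma shiftedRegression_lt {c : ℝ} (p L : ℝ) (hc : 0 < c) (δ x : Query) (h : x < δ) :
    shiftedRegression c p L δ x < 1 / 2 := by
  rw [shiftedRegression, if_pos h]
  have h' : (x : ℝ) < δ := h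
  have := Real.rpow_pos_of_pos (sub_pos.2 h') p
  nlinarith

lemma le_shiftedRegression {c : ℝ} (p L : ℝ) (hc : 0 < c) (δ x : Query) (h : δ ≤ x) :
    1 / 2 ≤ shiftedRegression c p L δ x := by
  rw [shiftedRegression, if_neg (not_lt.2 h)]
  have h' : (δ : ℝ) ≤ x := h
  have h1 := Real.rpow_nonneg (sub_nonneg.2 h') p
  have h2 := Real.rpow_nonneg x.2.1 p
  split_ifs <;> nlinarith

lemma abs_shiftedRegression_of_lt {c : ℝ} (p : ℝ) {L : ℝ} (hc : 0 < c) (δ x : Query)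
    (h : (x : ℝ) < L * δ) : |shiftedRegression c p L δ x - 1 / 2| = c * |(x : ℝ) - δ| ^ p := by
  rcases lt_or_ge x δ with hx | hx
  · have hx' : (x : ℝ) < δ := hx
    have := Real.rpow_nonneg (sub_pos.2 hx').le p
    rw [abs_of_neg (sub_neg.2 hx'), neg_sub, shiftedRegression, if_pos hx, abs_of_nonpos] <;>
      nlinarith
  · have hx' : (δ : ℝ) ≤ x := hx
    have := Real.rpow_nonneg (sub_nonneg.2 hx') p
    rw [abs_of_nonneg (sub_nonneg.2 hx'), shiftedRegression, if_neg (not_lt.2 hx), if_pos h,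
      abs_of_nonneg] <;> nlinarith

/-- The value `L = C / (C - c)` is chosen so that `x ≥ L * δ` is equivalent to `(c / C) * x ≤ x -
δ`. Since `p ≤ 1` gives `c / C ≤ (c / C) ^ p`, the unshifted branch then obeys the upper bound
around `δ`. This is where `κ ≤ 2` enters. -/
lemma abs_shiftedRegression_le {c C p : ℝ} (hc : 0 < c) (hcC : c < C) (hp0 : 0 ≤ p) (hp1 : p ≤ 1)
    (δ x : Query) :
    |shiftedRegression c p (C / (C - c)) δ x - 1 / 2| ≤ C * |(x : ℝ) - δ| ^ p := by
  have hCc : 0 < C - c := sub_pos.2 hcC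
  have hL : 1 ≤ C / (C - c) := (one_le_div hCc).2 (by linarith)
  have hδ := δ.2.1
  rcases lt_or_ge (x : ℝ) (C / (C - c) * δ) with h | h
  · rw [abs_shiftedRegression_of_lt p hc δ x h]
    gcongr
  · have hx : (δ : ℝ) ≤ x := by nlinarith
    have hx0 : (0 : ℝ) ≤ x := x.2.1
    have hC0 : 0 < C := hc.trans hcC
    have hδx : c / C * x ≤ x - δ := by
      rw [div_mul_eq_mul_div, div_le_iff₀ hCc] at h
      rw [div_mul_eq_mul_div, div_le_iff₀ hC0]
      linarith
    have hcCle : c / C ≤ (c / C) ^ p := by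
      simpa using Real.rpow_le_rpow_of_exponent_ge (by positivity) ((div_le_one hC0).2 hcC.le) hp1
    have hxp : 0 ≤ (x : ℝ) ^ p := Real.rpow_nonneg hx0 p
    rw [shiftedRegression, if_neg (not_lt.2 (show δ ≤ x from hx)), if_neg (not_lt.2 h),
      add_sub_cancel_left, abs_of_nonneg (by positivity), abs_of_nonneg (sub_nonneg.2 hx)]
    calc c * (x : ℝ) ^ p = C * (c / C * (x : ℝ) ^ p) := by field_simp
      _ ≤ C * ((c / C) ^ p * (x : ℝ) ^ p) := by gcongr
      _ = C * (c / C * x) ^ p := by rw [Real.mul_rpow (by positivity) hx0]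
      _ ≤ C * ((x : ℝ) - δ) ^ p := by gcongr

lemma power_mem_noiseClass {κ c C : ℝ} (hκ : 1 ≤ κ) (hc : 0 < c) (hcC : c < C) (hC : C < 1 / 2) :
    bernoulliKernel (powerRegression c (κ - 1)) (measurable_powerRegression c (κ - 1)) ∈
      noiseClass κ c C := by
  have hp : 0 ≤ κ - 1 := sub_nonneg.2 hκ
  have habs : ∀ x : Query, |powerRegression c (κ - 1) x - 1 / 2| = c * (x : ℝ) ^ (κ - 1) := by
    intro x
    rw [abs_of_nonneg (by linarith [(powerRegression_mem_Icc hc hp x).1]), powerRegression]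
    ring
  refine bernoulliKernel_mem_noiseClass _
    (fun x => Ioo_subset_Icc_self (powerRegression_mem_Ioo hc (by linarith) hp x)) 0
    (fun x hx => absurd x.2.1 (not_le.2 hx)) (fun x _ => (powerRegression_mem_Icc hc hp x).1)
    (fun x => ?_) (Eventually.of_forall fun x => ?_)
  · have := Real.rpow_nonneg x.2.1 (κ - 1)
    simp only [habs, Set.Icc.coe_zero, sub_zero, abs_of_nonneg x.2.1]
    gcongr
  · simp only [habs, Set.Icc.coe_zero, sub_zero, abs_of_nonneg x.2.1, le_refl]

lemma shifted_mem_noiseClass {κ c C : ℝ} (hκ : 1 ≤ κ) (hκ2 : κ ≤ 2) (hc : 0 < c) (hcC : c < C)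
    (hC : C < 1 / 2) {δ : Query} (hδ : 0 < (δ : ℝ)) :
    bernoulliKernel (shiftedRegression c (κ - 1) (C / (C - c)) δ)
      (measurable_shiftedRegression c (κ - 1) (C / (C - c)) δ) ∈ noiseClass κ c C := by
  have hL : 1 < C / (C - c) := (one_lt_div (by linarith)).2 (by linarith)
  refine bernoulliKernel_mem_noiseClass _
    (shiftedRegression_mem_Icc _ hc (by linarith) (by linarith) δ) δ
    (shiftedRegression_lt _ _ hc δ) (le_shiftedRegression _ _ hc δ)
    (abs_shiftedRegression_le hc hcC (by linarith) (by linarith) δ) ?_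
  -- As `L > 1`, the lower noise bound holds with equality in a neighbourhood of `δ`.
  have hnear : ∀ᶠ x : Query in 𝓝 δ, (x : ℝ) < C / (C - c) * δ :=
    continuous_subtype_val.continuousAt.eventually_lt continuousAt_const (by nlinarith)
  filter_upwards [hnear] with x hx
  rw [abs_shiftedRegression_of_lt _ hc δ x hx]

/-- The two functions differ only for `x < L * δ`, where each is within `c * (L * δ) ^ p` of `1/2`;
the reference variance is at least `1/4 - c²`. -/
lemma sq_shifted_sub_power_le {c p L : ℝ} (hc : 0 < c) (hc2 : c < 1 / 2) (hp : 0 ≤ p)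
    (hL : 1 ≤ L) (δ x : Query) :
    (shiftedRegression c p L δ x - powerRegression c p x) ^ 2 ≤
      4 * c ^ 2 * ((L * δ) ^ p) ^ 2 / (1 / 4 - c ^ 2) *
        (powerRegression c p x * (1 - powerRegression c p x)) := by
  have hw : 0 < 1 / 4 - c ^ 2 := by nlinarith
  obtain ⟨hq1, hq2⟩ := powerRegression_mem_Icc hc hp x
  have hq : 1 / 4 - c ^ 2 ≤ powerRegression c p x * (1 - powerRegression c p x) := by nlinarith
  have hδ : (0 : ℝ) ≤ δ := δ.2.1
  have hx0 : (0 : ℝ) ≤ x := x.2.1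
  have hsq : (shiftedRegression c p L δ x - powerRegression c p x) ^ 2 ≤
      4 * c ^ 2 * ((L * δ) ^ p) ^ 2 := by
    rcases lt_or_ge (x : ℝ) (L * δ) with h | h
    · have h1 := abs_shiftedRegression_of_lt p hc δ x h
      have h2 : |(x : ℝ) - δ| ^ p ≤ (L * δ) ^ p :=
        Real.rpow_le_rpow (abs_nonneg _) (abs_le.2 ⟨by nlinarith, by nlinarith⟩) hp
      have h3 : (x : ℝ) ^ p ≤ (L * δ) ^ p := Real.rpow_le_rpow hx0 h.le hp
      have h4 : |shiftedRegression c p L δ x - powerRegression c p x| ≤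
          2 * c * (L * δ) ^ p := by
        calc _ ≤ |shiftedRegression c p L δ x - 1 / 2| + |1 / 2 - powerRegression c p x| :=
              abs_sub_le _ _ _
          _ = c * |(x : ℝ) - δ| ^ p + c * (x : ℝ) ^ p := by
              rw [h1, abs_of_nonpos (sub_nonpos.2 hq1), powerRegression]
              ring
          _ ≤ c * (L * δ) ^ p + c * (L * δ) ^ p := by gcongr
          _ = _ := by ring
      calc _ = |shiftedRegression c p L δ x - powerRegression c p x| ^ 2 := (sq_abs _).symm
        _ ≤ (2 * c * (L * δ) ^ p) ^ 2 := by gcongr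
        _ = _ := by ring
    · have hx : δ ≤ x := show (δ : ℝ) ≤ x by nlinarith
      rw [shiftedRegression, if_neg (not_lt.2 hx), if_neg (not_lt.2 h), powerRegression, sub_self,
        zero_pow two_ne_zero]
      exact mul_nonneg (by positivity) (sq_nonneg _)
  refine hsq.trans ?_
  rw [div_mul_eq_mul_div, le_div_iff₀ hw]
  gcongr

/-- An output to the right of `δ/2` errs on `[δ/4, δ/2)`, a stretch that stays `δ/4` away from the
true threshold `0`. -/
lemma excessRisk_power_ge {c p : ℝ} (hc : 0 < c) (hc2 : c < 1 / 2) (hp : 0 ≤ p) {δ x : Query}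
    (hx : (δ : ℝ) / 2 ≤ x) :
    2 * (c * ((δ : ℝ) / 4) ^ p) * (δ / 4) ≤
      excessRisk (bernoulliKernel (powerRegression c p) (measurable_powerRegression c p)) x := by
  have h01 := fun x => Ioo_subset_Icc_self (powerRegression_mem_Ioo hc hc2 hp x)
  have := isMarkovKernel_bernoulliKernel (measurable_powerRegression c p) h01
  have hδ0 := δ.2.1
  have hδ1 := δ.2.2
  let a : Query := ⟨δ / 4, by linarith, by linarith⟩
  let b : Query := ⟨δ / 2, by linarith, by linarith⟩
  have hab : a ≤ b := show (δ : ℝ) / 4 ≤ δ / 2 by linarith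
  have h := mul_volume_le_excessRisk
    (bernoulliKernel (powerRegression c p) (measurable_powerRegression c p)) x
    (S := Ico a b) measurableSet_Ico (m := c * ((δ : ℝ) / 4) ^ p)
    (fun y hy => thresholdClassifier_ne_bayesClassifier _ h01 (θ := 0)
      (fun x hx => absurd x.2.1 (not_le.2 hx)) (fun x _ => (powerRegression_mem_Icc hc hp x).1)
      ⟨(min_le_right _ _).trans y.2.1, (hy.2.trans_le hx).trans_le (le_max_left _ _)⟩)
    (fun y hy => by
      have hy1 : (δ : ℝ) / 4 ≤ y := hy.1
      rw [regression_bernoulliKernel _ h01]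
      refine le_trans ?_ (le_abs_self _)
      rw [powerRegression, add_sub_cancel_left]
      gcongr)
  rw [volume_real_Ico a b hab] at h
  convert h using 2
  change (δ : ℝ) / 4 = δ / 2 - δ / 4
  ring

/-- The mirror case: an output to the left of `δ/2` errs on `[δ/2, 3δ/4)`, again `δ/4` away from the
true threshold `δ`. -/
lemma excessRisk_shifted_ge {c p L : ℝ} (hc : 0 < c) (hc2 : c < 1 / 2) (hp : 0 ≤ p)
    (hL : 1 ≤ L) {δ x : Query} (hx : (x : ℝ) ≤ δ / 2) :
    2 * (c * ((δ : ℝ) / 4) ^ p) * (δ / 4) ≤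
      excessRisk (bernoulliKernel (shiftedRegression c p L δ)
        (measurable_shiftedRegression c p L δ)) x := by
  have h01 := shiftedRegression_mem_Icc L hc hc2 hp δ
  have := isMarkovKernel_bernoulliKernel (measurable_shiftedRegression c p L δ) h01
  have hδ0 := δ.2.1
  have hδ1 := δ.2.2
  let a : Query := ⟨δ / 2, by linarith, by linarith⟩
  let b : Query := ⟨3 * δ / 4, by linarith, by linarith⟩
  have hab : a ≤ b := show (δ : ℝ) / 2 ≤ 3 * δ / 4 by linarith
  have hbδ : b ≤ δ := show 3 * (δ : ℝ) / 4 ≤ δ by linarith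
  have h := mul_volume_le_excessRisk
    (bernoulliKernel (shiftedRegression c p L δ) (measurable_shiftedRegression c p L δ)) x
    (S := Ico a b) measurableSet_Ico (m := c * ((δ : ℝ) / 4) ^ p)
    (fun y hy => thresholdClassifier_ne_bayesClassifier _ h01 (shiftedRegression_lt p L hc δ)
      (le_shiftedRegression p L hc δ)
      ⟨(min_le_left _ _).trans ((show x ≤ a from hx).trans hy.1),
        (hy.2.trans_le hbδ).trans_le (le_max_right _ _)⟩)
    (fun y hy => by
      have hy2 : (y : ℝ) < 3 * δ / 4 := hy.2
      rw [regression_bernoulliKernel _ h01,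
        abs_shiftedRegression_of_lt p hc δ y (by nlinarith)]
      gcongr
      rw [abs_sub_comm]
      exact le_trans (by linarith) (le_abs_self _))
  rw [volume_real_Ico a b hab] at h
  convert h using 2
  change (δ : ℝ) / 4 = 3 * δ / 4 - δ / 2
  ring

/-- The two-point bound for a pair of thresholds at distance `δ`. -/
lemma le_worstExcessRisk_of_two_points {κ c C : ℝ} (hκ : 1 ≤ κ) (hκ2 : κ ≤ 2) (hc : 0 < c)
    (hcC : c < C) (hC : C < 1 / 2) (A : Strategy) (t : ℕ) {δ : Query} (hδ : 0 < (δ : ℝ)) {B : ℝ}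
    (hB : (1 + 4 * c ^ 2 * ((C / (C - c) * δ) ^ (κ - 1)) ^ 2 / (1 / 4 - c ^ 2)) ^ t ≤ B) :
    3 / 4 * (2 * (c * ((δ : ℝ) / 4) ^ (κ - 1)) * (δ / 4)) ≤
      (B + 1) * worstExcessRisk κ c C A t := by
  have hp : 0 ≤ κ - 1 := by linarith
  have hc2 : c < 1 / 2 := by linarith
  have hw : 0 < 1 / 4 - c ^ 2 := by nlinarith
  have hL : 1 ≤ C / (C - c) := (one_le_div (by linarith)).2 (by linarith)
  have hm0 := measurable_powerRegression c (κ - 1)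
  have hm1 := measurable_shiftedRegression c (κ - 1) (C / (C - c)) δ
  have hq := powerRegression_mem_Ioo hc hc2 hp
  have h01 := shiftedRegression_mem_Icc (C / (C - c)) hc hc2 hp δ
  have := isMarkovKernel_bernoulliKernel hm0 fun x => Ioo_subset_Icc_self (hq x)
  have := isMarkovKernel_bernoulliKernel hm1 h01
  let S : Set (Fin t → Query × Label) := {h | (δ : ℝ) / 2 ≤ A.query t h}
  have hS : MeasurableSet S :=
    measurableSet_le measurable_const (measurable_subtype_coe.comp (A.measurable_query t))
  have hsq := sq_real_historyLaw_le A hm1 hm0 (by positivity) h01 hq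
    (sq_shifted_sub_power_le hc hc2 hp hL δ) t hS
  have hr0 := (mul_historyLaw_le_expectedExcessRisk A (bernoulliKernel _ hm0) t hS
    fun h hh => excessRisk_power_ge hc hc2 hp hh).trans
    (expectedExcessRisk_le_worstExcessRisk A (power_mem_noiseClass hκ hc hcC hC) t)
  have hr1 := (mul_historyLaw_le_expectedExcessRisk A (bernoulliKernel _ hm1) t hS.compl
    fun h hh => excessRisk_shifted_ge hc hc2 hp hL
      (not_le.1 (show ¬(δ : ℝ) / 2 ≤ A.query t h from hh)).le).trans
    (expectedExcessRisk_le_worstExcessRisk A (shifted_mem_noiseClass hκ hκ2 hc hcC hC hδ) t)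
  rw [probReal_compl_eq_one_sub hS] at hr1
  set μ := (historyLaw A (bernoulliKernel _ hm1) t).real S
  set ν := (historyLaw A (bernoulliKernel _ hm0) t).real S
  set m := 2 * (c * ((δ : ℝ) / 4) ^ (κ - 1)) * (δ / 4)
  set r := worstExcessRisk κ c C A t
  have hm : 0 ≤ m := by positivity
  have hν : 0 ≤ ν := measureReal_nonneg
  have hB0 : 0 ≤ B := le_trans (by positivity) hB
  -- The constant `3/4` is the minimum of `μ² + 1 - μ`, attained at `μ = 1/2`.
  calc 3 / 4 * m ≤ m * (μ ^ 2 + (1 - μ)) := by nlinarith [mul_nonneg hm (sq_nonneg (μ - 1 / 2))]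
    _ ≤ m * (B * ν + (1 - μ)) := by
      gcongr
      exact hsq.trans (by gcongr)
    _ = B * (m * ν) + m * (1 - μ) := by ring
    _ ≤ B * r + r := by gcongr
    _ = (B + 1) * r := by ring

lemma exists_rpow_le_worstExcessRisk {κ c C : ℝ} (hκ : 1 < κ) (hκ2 : κ ≤ 2) (hc : 0 < c)
    (hcC : c < C) (hC : C < 1 / 2) :
    ∃ K : ℝ, 0 < K ∧ ∀ (A : Strategy) (t : ℕ),
      K * ((t : ℝ) + 1) ^ (-(κ / (2 * κ - 2))) ≤ worstExcessRisk κ c C A t := by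
  have hκ' : 0 < 2 * κ - 2 := by linarith
  have hL : 0 < C / (C - c) := div_pos (by linarith) (by linarith)
  have hw : 0 < 1 / 4 - c ^ 2 := by nlinarith
  set M := 4 * c ^ 2 * ((C / (C - c)) ^ (κ - 1)) ^ 2 / (1 / 4 - c ^ 2) with hM
  have hM0 : 0 < M := by positivity
  refine ⟨3 / 4 * (2 * c * (1 / 4) ^ κ) / (Real.exp M + 1), by positivity, fun A t => ?_⟩
  have ht : (0 : ℝ) < t + 1 := by positivity
  -- This scale makes `δ^(2κ-2) = 1/(t+1)`, so `t` labels accumulate a factor at most `exp M`.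
  let δ : Query := ⟨((t : ℝ) + 1) ^ (-(1 / (2 * κ - 2))), by positivity,
    Real.rpow_le_one_of_one_le_of_nonpos (by linarith [(t.cast_nonneg : (0 : ℝ) ≤ t)])
      (neg_nonpos.2 (by positivity))⟩
  have hδ : (0 : ℝ) < δ := Real.rpow_pos_of_pos ht _
  have hδ2 : (((δ : ℝ)) ^ (κ - 1)) ^ 2 = ((t : ℝ) + 1)⁻¹ := by
    change (((((t : ℝ) + 1) ^ (-(1 / (2 * κ - 2)))) ^ (κ - 1))) ^ 2 = _
    rw [← Real.rpow_mul ht.le, ← Real.rpow_natCast, ← Real.rpow_mul ht.le,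
      ← Real.rpow_neg_one]
    congr 1
    calc _ = -((2 * κ - 2) / (2 * κ - 2)) := by push_cast; ring
      _ = -1 := by rw [div_self hκ'.ne']
  have hδκ : (δ : ℝ) ^ κ = ((t : ℝ) + 1) ^ (-(κ / (2 * κ - 2))) := by
    change (((t : ℝ) + 1) ^ (-(1 / (2 * κ - 2)))) ^ κ = _
    rw [← Real.rpow_mul ht.le]
    congr 1
    ring
  have hβ : 4 * c ^ 2 * ((C / (C - c) * δ) ^ (κ - 1)) ^ 2 / (1 / 4 - c ^ 2) = M / (t + 1) := by
    rw [Real.mul_rpow hL.le hδ.le, mul_pow, hδ2, hM]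
    ring
  have hB : (1 + 4 * c ^ 2 * ((C / (C - c) * δ) ^ (κ - 1)) ^ 2 / (1 / 4 - c ^ 2)) ^ t ≤
      Real.exp M := by
    rw [hβ]
    calc (1 + M / ((t : ℝ) + 1)) ^ t ≤ (Real.exp (M / (t + 1))) ^ t := by
          gcongr
          linarith [Real.add_one_le_exp (M / ((t : ℝ) + 1))]
      _ = Real.exp (t * (M / (t + 1))) := (Real.exp_nat_mul _ _).symm
      _ ≤ Real.exp M := by
          refine Real.exp_le_exp.2 ?_
          rw [mul_div_assoc', div_le_iff₀ ht]
          nlinarith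
  have h := le_worstExcessRisk_of_two_points hκ.le hκ2 hc hcC hC A t hδ hB
  have hpow : ((δ : ℝ) / 4) ^ (κ - 1) * (δ / 4) = (1 / 4) ^ κ * (δ : ℝ) ^ κ := by
    rw [← Real.rpow_add_one (by positivity), sub_add_cancel,
      ← Real.mul_rpow (by norm_num) hδ.le]
    congr 1
    ring
  rw [div_mul_eq_mul_div, div_le_iff₀ (by positivity), ← hδκ]
  calc 3 / 4 * (2 * c * (1 / 4) ^ κ) * (δ : ℝ) ^ κ
      = 3 / 4 * (2 * c * ((1 / 4) ^ κ * (δ : ℝ) ^ κ)) := by ring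
    _ = 3 / 4 * (2 * (c * ((δ : ℝ) / 4) ^ (κ - 1)) * (δ / 4)) := by rw [← hpow]; ring
    _ ≤ _ := h
    _ = _ := by ring

lemma le_of_rpow_le_isBigO {a γ K : ℝ} (hK : 0 < K) {r : ℕ → ℝ}
    (hr : ∀ t : ℕ, K * ((t : ℝ) + 1) ^ (-a) ≤ r t)
    (hO : r =O[atTop] fun t : ℕ => ((t : ℝ) + 1) ^ (-γ)) : γ ≤ a := by
  by_contra! hlt
  obtain ⟨D, hD⟩ := hO.bound
  have hlim : Tendsto (fun t : ℕ => ((t : ℝ) + 1) ^ (γ - a)) atTop atTop :=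
    (tendsto_rpow_atTop (sub_pos.2 hlt)).comp
      (tendsto_atTop_add_const_right _ _ tendsto_natCast_atTop_atTop)
  obtain ⟨t, h1, h2⟩ := (hD.and (hlim.eventually_gt_atTop (D / K))).exists
  have ht : (0 : ℝ) < t + 1 := by positivity
  have hpos := Real.rpow_pos_of_pos ht (-γ)
  rw [Real.norm_of_nonneg hpos.le] at h1
  have h3 := (hr t).trans ((Real.le_norm_self _).trans h1)
  have h4 : ((t : ℝ) + 1) ^ (-a) = ((t : ℝ) + 1) ^ (γ - a) * ((t : ℝ) + 1) ^ (-γ) := by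
    rw [← Real.rpow_add ht]
    congr 1
    ring
  rw [h4, ← mul_assoc] at h3
  have h5 := le_of_mul_le_mul_right h3 hpos
  rw [div_lt_iff₀ hK] at h2
  linarith

end ActiveLearning

/-- The index `t` counts the labels already seen and so stands for time `t + 1`; this is the shift
in both rates. -/
theorem mainTheorem8 (c C : ℝ) (hc : 0 < c) (hcC : c < C) (hC : C < 1 / 2) :
    (∀ κ : ℝ, 1 < κ → κ ≤ 2 → ∀ γ : ℝ, 0 < γ →
      (∃ A : ActiveLearning.Strategy,
        (fun t : ℕ => ActiveLearning.worstExcessRisk κ c C A t)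
          =O[atTop] (fun t : ℕ => ((t : ℝ) + 1) ^ (-γ))) →
      γ ≤ κ / (2 * κ - 2)) ∧
    (∃ K : ℝ, 0 < K ∧ ∀ (A : ActiveLearning.Strategy) (t : ℕ),
      K * (2 : ℝ) ^ (-(6 * C ^ 2 * ((t : ℝ) + 1))) ≤
        ActiveLearning.worstExcessRisk 1 c C A t) := by
  refine ⟨fun κ hκ hκ2 γ _ => ?_, c / 10, by positivity,
    ActiveLearning.worstExcessRisk_one_ge hc hcC hC⟩
  rintro ⟨A, hA⟩
  obtain ⟨K, hK, hr⟩ := ActiveLearning.exists_rpow_le_worstExcessRisk hκ hκ2 hc hcC hC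
  exact ActiveLearning.le_of_rpow_le_isBigO hK (hr A) hA
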